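/- For $n\ge 1$ and $\pi\in S_n$ let $l(\pi)=\#\{(i,j): 1\le i<j\le n,\ \pi(i)>\pi(j)\}$ be the number of inversions of $\pi$, and for $q>0$ let $\mu_{n,q}$ be the Mallows measure on $S_n$, $\mu_{n,q}(\pi)=q^{l(\pi)}/Z_{n,q}$ with $Z_{n,q}=\sum_{\rho\in S_n}q^{l(\rho)}$. For $\pi,\tau\in S_n$ let $\mathrm{LCS}(\pi,\tau)$ be the length of their longest common subsequence, i.e. the largest $m$ for which there are indices $i_1<\cdots<i_m$ and $j_1<\cdots<j_m$ with $\pi(i_k)=\tau(j_k)$ for all $1\le k\le m$. Theorem 1.2. Let $0<q,q'<1$. There exist constants $\sigma=\sigma(q,q')>0$ and $a=a(q,q')>0$ such that the following holds: if for each $n\ge1$ the random variables $\pi_n,\tau_n$ are independent with $\pi_n\sim\mu_{n,q}$ and $\tau_n\sim\mu_{n,q'}$, then $$\frac{\mathrm{LCS}(\pi_n,\tau_n)-an}{\sigma\sqrt n}\ \overset{d}{\longrightarrow}\ \mathcal N(0,1)\qquad\text{as } n\to\infty,$$ where $\overset{d}{\longrightarrow}$ denotes convergence in distribution and $\mathcal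 N(0,1)$ is the standard normal distribution. -/

import Mathlib

open MeasureTheory ProbabilityTheory Filter
open scoped Topology ENNReal

noncomputable section

namespace Mallows

/-- The lengths `m` of common subsequences of `π` and `τ`: there are `i₁ < ⋯ < i_m` and
`j₁ < ⋯ < j_m` such that `π(i_k) = τ(j_k)` for all `k`. -/
def commonSubseqLengths {n : ℕ} (π τ : Equiv.Perm (Fin n)) : Set ℕ :=
  {m | ∃ i j : Fin m → Fin n, StrictMono i ∧ StrictMono j ∧ ∀ k, π (i k) = τ (j k)}

/-- The length of the longest common subsequence of two permutations; the supremum is a maximum,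
see `isGreatest_lcs`. -/
def lcs {n : ℕ} (π τ : Equiv.Perm (Fin n)) : ℕ :=
  sSup (commonSubseqLengths π τ)

theorem isGreatest_lcs {n : ℕ} (π τ : Equiv.Perm (Fin n)) :
    IsGreatest (commonSubseqLengths π τ) (lcs π τ) := by
  have hb : BddAbove (commonSubseqLengths π τ) := by
    refine ⟨n, ?_⟩
    rintro m ⟨i, -, hi, -, -⟩
    simpa using Fintype.card_le_of_injective i hi.injective
  have hne : (commonSubseqLengths π τ).Nonempty :=
    ⟨0, Fin.elim0, Fin.elim0, fun a => a.elim0, fun a => a.elim0, fun a => a.elim0⟩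
  exact ⟨Nat.sSup_mem hne hb, fun m hm => le_csSup hb hm⟩

/-- The inversion set `Inv(π)` of a permutation. -/
def inversionSet {n : ℕ} (π : Equiv.Perm (Fin n)) : Finset (Fin n × Fin n) :=
  {p | p.1 < p.2 ∧ π p.2 < π p.1}

/-- The inversion number `l(π)` of a permutation. -/
def inversionNumber {n : ℕ} (π : Equiv.Perm (Fin n)) : ℕ :=
  (inversionSet π).card

/-- The normalizing constant `Z_{n,q}`. -/
def normalizer (n : ℕ) (q : ℝ) : ℝ :=
  ∑ π : Equiv.Perm (Fin n), q ^ inversionNumber π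

/-- The symmetric group on `n` letters carries the discrete σ-algebra. -/
instance permMeasurableSpace (n : ℕ) : MeasurableSpace (Equiv.Perm (Fin n)) := ⊤

instance permDiscreteMeasurableSpace (n : ℕ) :
    DiscreteMeasurableSpace (Equiv.Perm (Fin n)) := ⟨fun _ => trivial⟩

/-- The Mallows measure `μ_{n,q}` on the symmetric group (for `q > 0`), giving mass
`q ^ l(π) / Z_{n,q}` to each permutation `π`. -/
def mallowsMeasure (n : ℕ) (q : ℝ) : Measure (Equiv.Perm (Fin n)) :=
  ∑ π : Equiv.Perm (Fin n),
    ENNReal.ofReal (q ^ inversionNumber π / normalizer n q) • Measure.dirac π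

theorem mallowsMeasure_singleton (n : ℕ) (q : ℝ) (π : Equiv.Perm (Fin n)) :
    mallowsMeasure n q {π} = ENNReal.ofReal (q ^ inversionNumber π / normalizer n q) := by
  classical
  simp [mallowsMeasure, Measure.finsetSum_apply, Set.indicator_apply]

theorem isProbabilityMeasure_mallowsMeasure (n : ℕ) {q : ℝ} (hq : 0 < q) :
    IsProbabilityMeasure (mallowsMeasure n q) := by
  have hZ : 0 < normalizer n q :=
    Finset.sum_pos (fun π _ => pow_pos hq _) Finset.univ_nonempty
  refine ⟨?_⟩
  simp only [mallowsMeasure, Measure.finsetSum_apply, Measure.smul_apply, measure_univ,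
    smul_eq_mul, mul_one]
  rw [← ENNReal.ofReal_sum_of_nonneg (fun π _ => (div_pos (pow_pos hq _) hZ).le),
    ← Finset.sum_div]
  change ENNReal.ofReal (normalizer n q / normalizer n q) = 1
  rw [div_self hZ.ne', ENNReal.ofReal_one]

end Mallows

end

/-! Call `k` a cut of a pair of permutations if both preserve the first `k` positions. Splitting at
its cuts writes a pair uniquely as a direct sum of blocks, which have no interior cut. Inversion
numbers and LCS lengths add over direct sums, so the weight `q ^ l(π) * q' ^ l(τ) * ((1 - q) * (1 -
q')) ^ n` is multiplicative, and so is its product with `exp (i θ (LCS - a n))`. Splitting off the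
first block gives a renewal equation `U (1 - B) = 1` between the generating functions of all pairs
and of blocks, for the plain and for the twisted weights. Thus the LCS is a renewal reward sum.

The product formula for `normalizer` shows that the total masses `u n` converge geometrically fast
to some `c > 0`. By `summable_sq_mul_of_renewal` the block size then has a finite second moment.

For `θ = t / (σ √n)` the twisted block masses perturb the plain ones by a total `Δ`, of order `1 /
n` because `a` is chosen to cancel the first-order term. By `tendsto_diagonal_of_renewal` the
twisted mass at size `n` behaves like `c (1 + c Δ) ^ n`, which tends to `c exp (-t² / 2)`. Dividing
by `u n` gives the characteristic function, and Lévy's continuity theorem concludes. -/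

namespace Mallows

/-! ### Direct sums: additivity of inversions and of the LCS. -/

/-- The direct sum of two permutations, acting on the first `k` and on the last `m` letters. -/
def directSum {k m : ℕ} (π : Equiv.Perm (Fin k)) (ρ : Equiv.Perm (Fin m)) :
    Equiv.Perm (Fin (k + m)) :=
  finSumFinEquiv.permCongr (Equiv.sumCongr π ρ)

@[simp]
theorem directSum_castAdd {k m : ℕ} (π : Equiv.Perm (Fin k)) (ρ : Equiv.Perm (Fin m)) (i : Fin k) :
    directSum π ρ (Fin.castAdd m i) = Fin.castAdd m (π i) := by
  simp [directSum, Equiv.permCongr_apply]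

@[simp]
theorem directSum_natAdd {k m : ℕ} (π : Equiv.Perm (Fin k)) (ρ : Equiv.Perm (Fin m)) (i : Fin m) :
    directSum π ρ (Fin.natAdd k i) = Fin.natAdd k (ρ i) := by
  simp [directSum, Equiv.permCongr_apply]

theorem directSum_mul {k m : ℕ} (π π' : Equiv.Perm (Fin k)) (ρ ρ' : Equiv.Perm (Fin m)) :
    directSum (π * π') (ρ * ρ') = directSum π ρ * directSum π' ρ' := by
  ext i
  refine Fin.addCases (fun i => ?_) (fun i => ?_) i <;> simp

theorem directSum_inv {k m : ℕ} (π : Equiv.Perm (Fin k)) (ρ : Equiv.Perm (Fin m)) :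
    directSum π⁻¹ ρ⁻¹ = (directSum π ρ)⁻¹ := by
  rw [eq_inv_iff_mul_eq_one, ← directSum_mul]
  ext i
  refine Fin.addCases (fun i => ?_) (fun i => ?_) i <;> simp

theorem directSum_injective {k m : ℕ} {π π' : Equiv.Perm (Fin k)} {ρ ρ' : Equiv.Perm (Fin m)}
    (h : directSum π ρ = directSum π' ρ') : π = π' ∧ ρ = ρ' := by
  constructor
  · ext i
    have := congrArg (fun σ => ((σ (Fin.castAdd m i) : Fin (k + m)) : ℕ)) h
    simpa using this
  · ext i
    have := congrArg (fun σ => ((σ (Fin.natAdd k i) : Fin (k + m)) : ℕ)) h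
    simpa using this

theorem exists_directSum {k m : ℕ} (σ : Equiv.Perm (Fin (k + m)))
    (h : ∀ i : Fin (k + m), (i : ℕ) < k → (σ i : ℕ) < k) : ∃ π ρ, directSum π ρ = σ := by
  have hmem : finSumFinEquiv.symm.permCongr σ ∈
      (Equiv.Perm.sumCongrHom (Fin k) (Fin m)).range := by
    apply Equiv.Perm.mem_sumCongrHom_range_of_perm_mapsTo_inl
    rintro _ ⟨i, rfl⟩
    have hi := h (Fin.castAdd m i) (by simp)
    refine ⟨⟨_, hi⟩, ?_⟩
    simp only [Equiv.permCongr_apply, Equiv.symm_symm, finSumFinEquiv_apply_left]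
    rw [Equiv.eq_symm_apply]
    ext
    simp
  obtain ⟨⟨π, ρ⟩, hp⟩ := hmem
  refine ⟨π, ρ, ?_⟩
  have hp' : Equiv.sumCongr π ρ = finSumFinEquiv.symm.permCongr σ := hp
  rw [directSum, hp']
  ext i
  simp [Equiv.permCongr_apply]

theorem inversionNumber_eq_sum {n : ℕ} (π : Equiv.Perm (Fin n)) :
    inversionNumber π = ∑ i, ∑ j, if i < j ∧ π j < π i then 1 else 0 := by
  rw [inversionNumber, inversionSet, Finset.card_filter, ← Finset.univ_product_univ,
    Finset.sum_product]

theorem inversionNumber_directSum {k m : ℕ} (π : Equiv.Perm (Fin k)) (ρ : Equiv.Perm (Fin m)) :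
    inversionNumber (directSum π ρ) = inversionNumber π + inversionNumber ρ := by
  have h1 (i : Fin k) (j : Fin m) : ¬ Fin.natAdd k j < Fin.castAdd m i := by
    simp [Fin.lt_def]; omega
  simp only [inversionNumber_eq_sum, Fin.sum_univ_add, directSum_castAdd, directSum_natAdd]
  have h2 (i j : Fin k) : Fin.castAdd m i < Fin.castAdd m j ↔ i < j := Iff.rfl
  simp [h1, h2]

/-- The positions `i` determine `j = τ⁻¹ π i`, so a common subsequence is just a set of positions on
which `τ⁻¹ π` increases. -/
theorem mem_commonSubseqLengths_iff {n : ℕ} (π τ : Equiv.Perm (Fin n)) (m : ℕ) :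
    m ∈ commonSubseqLengths π τ ↔
      ∃ S : Finset (Fin n), S.card = m ∧ StrictMonoOn (τ⁻¹ * π : Equiv.Perm (Fin n)) S := by
  constructor
  · rintro ⟨i, j, hi, hj, h⟩
    refine ⟨Finset.univ.map ⟨i, hi.injective⟩, by simp, ?_⟩
    intro x hx y hy hxy
    simp only [Finset.coe_map, Function.Embedding.coeFn_mk, Finset.coe_univ, Set.image_univ,
      Set.mem_range] at hx hy
    obtain ⟨x, rfl⟩ := hx
    obtain ⟨y, rfl⟩ := hy
    simpa [h] using hj (hi.lt_iff_lt.1 hxy)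
  · rintro ⟨S, rfl, hS⟩
    refine ⟨S.orderEmbOfFin rfl, fun x => (τ⁻¹ * π) (S.orderEmbOfFin rfl x),
      (S.orderEmbOfFin rfl).strictMono, ?_, fun x => by simp⟩
    intro x y hxy
    exact hS (by simp) (by simp) ((S.orderEmbOfFin rfl).strictMono hxy)

theorem card_le_lcs {n : ℕ} {π τ : Equiv.Perm (Fin n)} {S : Finset (Fin n)}
    (hS : StrictMonoOn (τ⁻¹ * π : Equiv.Perm (Fin n)) S) : S.card ≤ lcs π τ :=
  (isGreatest_lcs π τ).2 ((mem_commonSubseqLengths_iff π τ _).2 ⟨S, rfl, hS⟩)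

theorem exists_card_eq_lcs {n : ℕ} (π τ : Equiv.Perm (Fin n)) :
    ∃ S : Finset (Fin n), S.card = lcs π τ ∧ StrictMonoOn (τ⁻¹ * π : Equiv.Perm (Fin n)) S :=
  (mem_commonSubseqLengths_iff π τ _).1 (isGreatest_lcs π τ).1

theorem lcs_le {n : ℕ} (π τ : Equiv.Perm (Fin n)) : lcs π τ ≤ n := by
  obtain ⟨S, hS, -⟩ := exists_card_eq_lcs π τ
  rw [← hS]
  exact S.card_le_univ.trans_eq (by simp)

/-- Here `τ⁻¹ π` is itself a direct sum, and it keeps the first summand below the second. Hence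
increasing sets restrict to the summands, and increasing sets of the summands can be joined. -/
theorem lcs_directSum {k m : ℕ} (π π' : Equiv.Perm (Fin k)) (ρ ρ' : Equiv.Perm (Fin m)) :
    lcs (directSum π ρ) (directSum π' ρ') = lcs π π' + lcs ρ ρ' := by
  have hσ : (directSum π' ρ')⁻¹ * directSum π ρ = directSum (π'⁻¹ * π) (ρ'⁻¹ * ρ) := by
    rw [directSum_mul, directSum_inv]
  apply le_antisymm
  · obtain ⟨S, hS, hmono⟩ := exists_card_eq_lcs (directSum π ρ) (directSum π' ρ')
    rw [hσ] at hmono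
    have h1 : (Finset.univ.filter fun i => Fin.castAdd m i ∈ S).card ≤ lcs π π' := by
      refine card_le_lcs fun x hx y hy hxy => ?_
      have := hmono (a := Fin.castAdd m x) (b := Fin.castAdd m y) (by simpa using hx)
        (by simpa using hy) hxy
      simpa only [directSum_castAdd, Fin.lt_def, Fin.val_castAdd] using this
    have h2 : (Finset.univ.filter fun i => Fin.natAdd k i ∈ S).card ≤ lcs ρ ρ' := by
      refine card_le_lcs fun x hx y hy hxy => ?_
      have := hmono (a := Fin.natAdd k x) (b := Fin.natAdd k y) (by simpa using hx)
        (by simpa using hy) (by simpa using hxy)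
      simpa only [directSum_natAdd, Fin.lt_def, Fin.val_natAdd, add_lt_add_iff_left] using this
    rw [← hS]
    calc S.card = ∑ i : Fin (k + m), if i ∈ S then 1 else 0 := by simp
      _ ≤ _ := by
        rw [Fin.sum_univ_add, ← Finset.card_filter, ← Finset.card_filter]
        exact add_le_add h1 h2
  · obtain ⟨S, hS, hSm⟩ := exists_card_eq_lcs π π'
    obtain ⟨T, hT, hTm⟩ := exists_card_eq_lcs ρ ρ'
    have hdisj : Disjoint (S.map (Fin.castAddEmb m)) (T.map (Fin.natAddEmb k)) := by
      rw [Finset.disjoint_left]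
      simp only [Finset.mem_map, not_exists, not_and, forall_exists_index, and_imp]
      rintro _ x _ rfl y _ h
      have := congrArg Fin.val h
      simp at this
      omega
    rw [← hS, ← hT, ← Finset.card_map (Fin.castAddEmb m), ← Finset.card_map (s := T) (Fin.natAddEmb k),
      ← Finset.card_union_of_disjoint hdisj]
    refine card_le_lcs ?_
    rw [hσ]
    intro x hx y hy hxy
    simp only [Finset.coe_union, Finset.coe_map, Set.mem_union, Set.mem_image, Finset.mem_coe,
      Fin.castAddEmb_apply, Fin.natAddEmb_apply] at hx hy
    rcases hx with ⟨x, hx, rfl⟩ | ⟨x, hx, rfl⟩ <;> rcases hy with ⟨y, hy, rfl⟩ | ⟨y, hy, rfl⟩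
    · simp only [directSum_castAdd, Fin.lt_def, Fin.val_castAdd] at hxy ⊢
      exact hSm hx hy hxy
    · simp only [directSum_castAdd, directSum_natAdd, Fin.lt_def, Fin.val_castAdd, Fin.val_natAdd]
      omega
    · simp only [Fin.lt_def, Fin.val_castAdd, Fin.val_natAdd] at hxy
      omega
    · simp only [directSum_natAdd, Fin.lt_def, Fin.val_natAdd, add_lt_add_iff_left] at hxy ⊢
      exact hTm hx hy hxy

/-! ### Cuts, blocks and the renewal equation. -/

/-- Both permutations of the pair preserve the initial segment of length `k`. -/
def IsCut {n : ℕ} (k : ℕ) (p : Equiv.Perm (Fin n) × Equiv.Perm (Fin n)) : Prop :=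
  ∀ i : Fin n, (i : ℕ) < k → (p.1 i : ℕ) < k ∧ (p.2 i : ℕ) < k

open Classical in
/-- The nonempty pairs of permutations that have no cut in the interior. -/
noncomputable def blocks (n : ℕ) : Finset (Equiv.Perm (Fin n) × Equiv.Perm (Fin n)) :=
  {p | 0 < n ∧ ∀ k, 0 < k → k < n → ¬ IsCut k p}

theorem mem_blocks {n : ℕ} {p : Equiv.Perm (Fin n) × Equiv.Perm (Fin n)} :
    p ∈ blocks n ↔ 0 < n ∧ ∀ k, 0 < k → k < n → ¬ IsCut k p := by
  simp [blocks]

/-- `k` is the least positive cut. -/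
def IsFirstCut {n : ℕ} (k : ℕ) (p : Equiv.Perm (Fin n) × Equiv.Perm (Fin n)) : Prop :=
  0 < k ∧ IsCut k p ∧ ∀ j, 0 < j → j < k → ¬ IsCut j p

theorem isCut_directSum_iff {k m j : ℕ} (hj : j ≤ k)
    (p : Equiv.Perm (Fin k) × Equiv.Perm (Fin k)) (r : Equiv.Perm (Fin m) × Equiv.Perm (Fin m)) :
    IsCut j (directSum p.1 r.1, directSum p.2 r.2) ↔ IsCut j p := by
  constructor
  · intro h i hi
    simpa using h (Fin.castAdd m i) (by simpa using hi)
  · intro h i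
    refine Fin.addCases (fun i hi => ?_) (fun i hi => ?_) i
    · simpa using h i (by simpa using hi)
    · simp at hi
      omega

theorem isCut_self {n : ℕ} (p : Equiv.Perm (Fin n) × Equiv.Perm (Fin n)) : IsCut n p :=
  fun i _ => ⟨(p.1 i).2, (p.2 i).2⟩

theorem existsUnique_isFirstCut {n : ℕ} (hn : 0 < n)
    (p : Equiv.Perm (Fin n) × Equiv.Perm (Fin n)) :
    ∃ k ≤ n, IsFirstCut k p ∧ ∀ j, IsFirstCut j p → j = k := by
  classical
  have hex : ∃ k, 0 < k ∧ IsCut k p := ⟨n, hn, isCut_self p⟩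
  refine ⟨Nat.find hex, Nat.find_min' hex ⟨hn, isCut_self p⟩,
    ⟨(Nat.find_spec hex).1, (Nat.find_spec hex).2, fun j hj hlt h => Nat.find_min hex hlt ⟨hj, h⟩⟩,
    fun j hj => ?_⟩
  refine le_antisymm ?_ (Nat.find_min' hex ⟨hj.1, hj.2.1⟩)
  by_contra! hlt
  exact hj.2.2 _ (Nat.find_spec hex).1 hlt (Nat.find_spec hex).2

/-- A function on pairs of permutations of all sizes that is multiplicative for direct sums. -/
def IsMultiplicative {R : Type*} [CommRing R]
    (f : ∀ n, Equiv.Perm (Fin n) × Equiv.Perm (Fin n) → R) : Prop :=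
  ∀ k m (p : Equiv.Perm (Fin k) × Equiv.Perm (Fin k)) (r : Equiv.Perm (Fin m) × Equiv.Perm (Fin m)),
    f (k + m) (directSum p.1 r.1, directSum p.2 r.2) = f k p * f m r

-- A pair with first cut `k` is uniquely the direct sum of a block of size `k` and an arbitrary pair
-- of size `m`.
open Classical in
theorem sum_isFirstCut {R : Type*} [CommRing R]
    {f : ∀ n, Equiv.Perm (Fin n) × Equiv.Perm (Fin n) → R}
    (hf : IsMultiplicative f) (k m : ℕ) :
    ∑ p with IsFirstCut k p, f (k + m) p = (∑ p ∈ blocks k, f k p) * ∑ r, f m r := by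
  rw [Finset.sum_mul_sum, ← Finset.sum_product']
  symm
  refine Finset.sum_bij
    (fun x _ => (directSum x.1.1 x.2.1, directSum x.1.2 x.2.2)) ?_ ?_ ?_ ?_
  · rintro ⟨p, r⟩ h
    simp only [Finset.mem_product, Finset.mem_univ, and_true, mem_blocks] at h
    simp only [Finset.mem_filter, Finset.mem_univ, true_and]
    refine ⟨h.1, (isCut_directSum_iff le_rfl p r).2 (isCut_self p), fun j hj hlt hc => ?_⟩
    exact h.2 j hj hlt ((isCut_directSum_iff hlt.le p r).1 hc)
  · rintro ⟨⟨a, b⟩, ⟨c, d⟩⟩ - ⟨⟨a', b'⟩, ⟨c', d'⟩⟩ - h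
    simp only [Prod.mk.injEq] at h
    obtain ⟨rfl, rfl⟩ := directSum_injective h.1
    obtain ⟨rfl, rfl⟩ := directSum_injective h.2
    rfl
  · rintro ⟨σ, σ'⟩ h
    simp only [Finset.mem_filter, Finset.mem_univ, true_and] at h
    obtain ⟨a, c, rfl⟩ := exists_directSum σ fun i hi => (h.2.1 i hi).1
    obtain ⟨b, d, rfl⟩ := exists_directSum σ' fun i hi => (h.2.1 i hi).2
    refine ⟨((a, b), (c, d)), ?_, rfl⟩
    simp only [Finset.mem_product, Finset.mem_univ, and_true, mem_blocks]
    exact ⟨h.1, fun j hj hlt hc =>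
      h.2.2 j hj hlt ((isCut_directSum_iff hlt.le (a, b) (c, d)).2 hc)⟩
  · rintro ⟨p, r⟩ -
    exact (hf k m p r).symm

/-- The renewal equation for sums over pairs of permutations. -/
theorem sum_eq_sum_antidiagonal {R : Type*} [CommRing R]
    {f : ∀ n, Equiv.Perm (Fin n) × Equiv.Perm (Fin n) → R}
    (hf : IsMultiplicative f) {n : ℕ} (hn : 0 < n) :
    ∑ p, f n p = ∑ x ∈ Finset.HasAntidiagonal.antidiagonal n, (∑ p ∈ blocks x.1, f x.1 p) * ∑ r, f x.2 r := by
  classical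
  have h1 (x : ℕ × ℕ) (hx : x ∈ Finset.HasAntidiagonal.antidiagonal n) :
      (∑ p ∈ blocks x.1, f x.1 p) * ∑ r, f x.2 r = ∑ p with IsFirstCut x.1 p, f n p := by
    obtain rfl := Finset.HasAntidiagonal.mem_antidiagonal.1 hx
    exact (sum_isFirstCut hf x.1 x.2).symm
  rw [Finset.sum_congr rfl h1]
  simp only [Finset.sum_filter]
  rw [Finset.sum_comm]
  refine Finset.sum_congr rfl fun p _ => ?_
  obtain ⟨k, hk, hcut, huniq⟩ := existsUnique_isFirstCut hn p
  rw [Finset.sum_eq_single (k, n - k), if_pos hcut]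
  · rintro ⟨a, b⟩ hab hne
    refine if_neg fun h => hne ?_
    have := huniq a h
    simp only [Finset.HasAntidiagonal.mem_antidiagonal] at hab
    simp only [Prod.mk.injEq]
    omega
  · intro h
    simp only [Finset.HasAntidiagonal.mem_antidiagonal] at h
    omega

/-! ### The product formula for the normalizer and its limit. -/

/-- The permutation that maps `0` to `p` and is order isomorphic to `e` on the other letters. -/
def insertFirst {n : ℕ} (p : Fin (n + 1)) (e : Equiv.Perm (Fin n)) : Equiv.Perm (Fin (n + 1)) :=
  (finSuccEquiv' 0).trans ((Equiv.optionCongr e).trans (finSuccEquiv' p).symm)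

@[simp]
theorem insertFirst_zero {n : ℕ} (p : Fin (n + 1)) (e : Equiv.Perm (Fin n)) :
    insertFirst p e 0 = p := by
  simp [insertFirst]

@[simp]
theorem insertFirst_succ {n : ℕ} (p : Fin (n + 1)) (e : Equiv.Perm (Fin n)) (i : Fin n) :
    insertFirst p e i.succ = p.succAbove (e i) := by
  have h : finSuccEquiv' (0 : Fin (n + 1)) i.succ = some i := by
    rw [← Fin.succAbove_zero, finSuccEquiv'_succAbove]
  simp [insertFirst, h]

theorem insertFirst_bijective (n : ℕ) :
    Function.Bijective fun x : Fin (n + 1) × Equiv.Perm (Fin n) => insertFirst x.1 x.2 := by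
  rw [Fintype.bijective_iff_injective_and_card]
  constructor
  · rintro ⟨p, e⟩ ⟨p', e'⟩ h
    have h0 : p = p' := by simpa using congrArg (fun σ => σ 0) h
    subst h0
    have : e = e' := by
      refine Equiv.ext fun i => ?_
      simpa using congrArg (fun σ => σ i.succ) h
    rw [this]
  · simp [Fintype.card_perm, Nat.factorial_succ]

/-- The value `p` in front is inverted with exactly the `p` smaller values; the other letters keep
the order given by `e`. -/
theorem inversionNumber_insertFirst {n : ℕ} (p : Fin (n + 1)) (e : Equiv.Perm (Fin n)) :
    inversionNumber (insertFirst p e) = p + inversionNumber e := by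
  simp only [inversionNumber_eq_sum, Fin.sum_univ_succ, insertFirst_zero, insertFirst_succ]
  have h : ∑ i : Fin n, (if p.succAbove (e i) < p then 1 else 0) = (p : ℕ) := by
    rw [Equiv.sum_comp e fun j => if p.succAbove j < p then 1 else 0, ← Finset.card_filter]
    simp only [Fin.succAbove_lt_iff_castSucc_lt]
    have : ∀ i : Fin n, i.castSucc < p ↔ (i : ℕ) < p := fun i => Iff.rfl
    simp only [this]
    rw [Fin.card_filter_val_lt]
    omega
  simp [h]

theorem normalizer_succ (n : ℕ) (q : ℝ) :
    normalizer (n + 1) q = (∑ i ∈ Finset.range (n + 1), q ^ i) * normalizer n q := by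
  rw [normalizer, ← (insertFirst_bijective n).sum_comp, ← Fin.sum_univ_eq_sum_range, normalizer,
    Finset.sum_mul_sum, ← Finset.univ_product_univ, Finset.sum_product]
  simp [inversionNumber_insertFirst, pow_add]

theorem normalizer_mul_pow (n : ℕ) (q : ℝ) :
    normalizer n q * (1 - q) ^ n = ∏ i ∈ Finset.range n, (1 - q ^ (i + 1)) := by
  induction n with
  | zero => simp [normalizer, inversionNumber, inversionSet]
  | succ n ih =>
    rw [Finset.prod_range_succ, ← ih, normalizer_succ, ← mul_neg_geom_sum q (n + 1)]
    ring

/-- `u n` is a partial product of factors `1 - O(r ^ i)` with `r = max q q'`, so it has a positive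
limit and a geometrically small error. -/
theorem exists_tendsto_normalizer_mul_pow {q q' : ℝ} (hq : 0 < q) (hq1 : q < 1) (hq' : 0 < q')
    (hq1' : q' < 1) {u : ℕ → ℝ}
    (hu : ∀ n, u n = normalizer n q * (1 - q) ^ n * (normalizer n q' * (1 - q') ^ n)) :
    ∃ c, 0 < c ∧ Tendsto u atTop (𝓝 c) ∧ Summable fun n => |u n - c| := by
  set s : ℕ → ℝ := fun i => (1 - q ^ (i + 1)) * (1 - q' ^ (i + 1)) with hs
  set r := max q q' with hr
  have hr0 : 0 ≤ r := hq.le.trans (le_max_left _ _)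
  have hr1 : r < 1 := max_lt hq1 hq1'
  have hlt {y : ℝ} (hy : 0 < y) (hy1 : y < 1) (i : ℕ) : 0 < 1 - y ^ (i + 1) :=
    sub_pos.2 (pow_lt_one₀ hy.le hy1 (by simp))
  have hs0 (i : ℕ) : 0 < s i := mul_pos (hlt hq hq1 i) (hlt hq' hq1' i)
  have hs1 (i : ℕ) : 1 - s i ≤ 2 * r ^ i := by
    have h1 : q ^ (i + 1) ≤ r ^ i := (pow_le_pow_of_le_one hq.le hq1.le (by simp)).trans
      (pow_le_pow_left₀ hq.le (le_max_left _ _) i)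
    have h2 : q' ^ (i + 1) ≤ r ^ i := (pow_le_pow_of_le_one hq'.le hq1'.le (by simp)).trans
      (pow_le_pow_left₀ hq'.le (le_max_right _ _) i)
    have h3 : 0 ≤ q ^ (i + 1) * q' ^ (i + 1) := by positivity
    simp only [hs]
    linarith
  have hs2 (i : ℕ) : s i ≤ 1 := by
    have h1 := hlt hq hq1 i
    have h2 := hlt hq' hq1' i
    have : 0 < q ^ (i + 1) := by positivity
    have : 0 < q' ^ (i + 1) := by positivity
    exact mul_le_one₀ (by linarith) h2.le (by linarith)
  have hu' (n : ℕ) : u n = ∏ i ∈ Finset.range n, s i := by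
    rw [hu, normalizer_mul_pow, normalizer_mul_pow, ← Finset.prod_mul_distrib]
  have hgeom : Summable fun i => 2 * r ^ i := (summable_geometric_of_lt_one hr0 hr1).mul_left 2
  have hsum : Summable fun i => ‖s i - 1‖ := by
    refine Summable.of_nonneg_of_le (fun i => norm_nonneg _) (fun i => ?_) hgeom
    rw [Real.norm_eq_abs, abs_sub_comm, abs_of_nonneg (sub_nonneg.2 (hs2 i))]
    exact hs1 i
  have hmul : Multipliable s := by
    have := multipliable_one_add_of_summable hsum
    simpa using this
  have hne : ∏' i, s i ≠ 0 := by
    have := tprod_one_add_ne_zero_of_summable (f := fun i => s i - 1)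
      (fun i => by simpa using (hs0 i).ne') hsum
    simpa using this
  have htend : Tendsto u atTop (𝓝 (∏' i, s i)) := by
    simpa only [← hu'] using hmul.hasProd.tendsto_prod_nat
  have hu0 (n : ℕ) : 0 ≤ u n := by
    rw [hu']
    exact Finset.prod_nonneg fun i _ => (hs0 i).le
  have hu1 (n : ℕ) : u n ≤ 1 := by
    rw [hu']
    exact Finset.prod_le_one (fun i _ => (hs0 i).le) fun i _ => hs2 i
  refine ⟨_, lt_of_le_of_ne (ge_of_tendsto' htend hu0) hne.symm, htend, ?_⟩
  have hd (n : ℕ) : dist (u n) (u (n + 1)) ≤ 2 * r ^ n := by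
    have : u n - u (n + 1) = u n * (1 - s n) := by
      rw [hu' (n + 1), Finset.prod_range_succ, ← hu']
      ring
    rw [Real.dist_eq, this, abs_of_nonneg (mul_nonneg (hu0 n) (sub_nonneg.2 (hs2 n)))]
    exact (mul_le_of_le_one_left (sub_nonneg.2 (hs2 n)) (hu1 n)).trans (hs1 n)
  exact Summable.of_nonneg_of_le (fun n => abs_nonneg _)
    (fun n => dist_le_of_le_geometric_of_tendsto r 2 hr1 hd htend n) (hgeom.div_const _)

/-! ### Moments of the step distribution of a renewal sequence. -/

theorem coeff_mul_mk {R : Type*} [CommRing R] (f g : ℕ → R) (n : ℕ) :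
    PowerSeries.coeff n (PowerSeries.mk f * PowerSeries.mk g) =
      ∑ k ∈ Finset.range (n + 1), f k * g (n - k) := by
  rw [PowerSeries.coeff_mul,
    Finset.Nat.sum_antidiagonal_eq_sum_range_succ_mk]
  simp

theorem mk_mul_mk_one {R : Type*} [CommRing R] (f : ℕ → R) :
    PowerSeries.mk f * PowerSeries.mk 1 =
      PowerSeries.mk fun n => ∑ k ∈ Finset.range (n + 1), f k := by
  ext n
  rw [coeff_mul_mk]
  simp

/-- If all tails of `f` are bounded by `R`, then moments of `f` are controlled by those of `R`. -/
theorem summable_mul_sum_of_tail_le {f g R : ℕ → ℝ} (hf : ∀ n, 0 ≤ f n) (hg : ∀ n, 0 ≤ g n)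
    (hR : ∀ n N, n < N → ∑ k ∈ Finset.Ico (n + 1) N, f k ≤ R n)
    (hsum : Summable fun n => g n * R n) :
    Summable fun k => f k * ∑ n ∈ Finset.range k, g n := by
  refine summable_of_sum_range_le (c := ∑' n, g n * R n)
    (fun k => mul_nonneg (hf k) (Finset.sum_nonneg fun n _ => hg n)) fun N => ?_
  have hR0 (n : ℕ) : 0 ≤ R n := by simpa using hR n (n + 1) (by simp)
  calc ∑ k ∈ Finset.range N, f k * ∑ n ∈ Finset.range k, g n
      = ∑ n ∈ Finset.range N, g n * ∑ k ∈ Finset.Ico (n + 1) N, f k := by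
        simp only [Finset.mul_sum]
        rw [Finset.sum_comm' (t' := Finset.range N) (s' := fun n => Finset.Ico (n + 1) N)]
        · simp only [mul_comm]
        · intro k n
          simp only [Finset.mem_range, Finset.mem_Ico]
          omega
    _ ≤ ∑ n ∈ Finset.range N, g n * R n :=
        Finset.sum_le_sum fun n hn =>
          mul_le_mul_of_nonneg_left (hR n N (Finset.mem_range.1 hn)) (hg n)
    _ ≤ ∑' n, g n * R n := hsum.sum_le_tsum _ fun n _ => mul_nonneg (hg n) (hR0 n)

/-- Keep only the first `N` terms of the convolution and let `n → ∞`. -/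
theorem mul_sum_range_le_of_convolution_le {f u B : ℕ → ℝ} {c L : ℝ} (hf : ∀ n, 0 ≤ f n)
    (hu : ∀ n, 0 ≤ u n) (hc : Tendsto u atTop (𝓝 c)) (hB : Tendsto B atTop (𝓝 L))
    (h : ∀ n, ∑ k ∈ Finset.range (n + 1), f k * u (n - k) ≤ B n) (N : ℕ) :
    c * ∑ k ∈ Finset.range N, f k ≤ L := by
  have h1 : Tendsto (fun n => ∑ k ∈ Finset.range N, f k * u (n - k)) atTop
      (𝓝 (∑ k ∈ Finset.range N, f k * c)) :=
    tendsto_finsetSum _ fun k _ => (hc.comp (tendsto_sub_atTop_nat k)).const_mul (f k)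
  rw [← Finset.sum_mul, mul_comm] at h1
  refine le_of_tendsto_of_tendsto h1 hB ?_
  filter_upwards [eventually_ge_atTop N] with n hn
  refine le_trans ?_ (h n)
  exact Finset.sum_le_sum_of_subset_of_nonneg (Finset.range_subset_range.2 (by omega))
    fun k _ _ => mul_nonneg (hf k) (hu _)

/-- A renewal sequence that converges summably fast to a positive limit comes from a
step distribution with finite second moment. -/
theorem summable_sq_mul_of_renewal {b u : ℕ → ℝ} {c : ℝ} (hb : ∀ n, 0 ≤ b n)
    (hu : ∀ n, 0 ≤ u n) (hren : PowerSeries.mk u * (1 - PowerSeries.mk b) = 1) (hc : 0 < c)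
    (hlim : Tendsto u atTop (𝓝 c)) (hsum : Summable fun n => |u n - c|) :
    Summable fun k : ℕ => (k : ℝ) ^ 2 * b k := by
  have hbu (n : ℕ) : ∑ k ∈ Finset.range (n + 1), b k * u (n - k) ≤ u n := by
    have h : PowerSeries.mk b * PowerSeries.mk u = PowerSeries.mk u - 1 := by
      linear_combination -hren
    rw [← coeff_mul_mk, h, map_sub, PowerSeries.coeff_mk, PowerSeries.coeff_one]
    split_ifs <;> linarith
  have hb1 (N : ℕ) : ∑ k ∈ Finset.range N, b k ≤ 1 := by
    have := mul_sum_range_le_of_convolution_le hb hu hlim hlim hbu N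
    exact (mul_le_iff_le_one_right hc).1 this
  -- `T` is the tail of `b`, with generating function `(1 - B) / (1 - x)`. The renewal equation
  -- turns this into `T * u = 1`, whose terms are split by the position of the last renewal.
  set T : ℕ → ℝ := fun n => 1 - ∑ k ∈ Finset.range (n + 1), b k with hT
  have hT0 (n : ℕ) : 0 ≤ T n := sub_nonneg.2 (hb1 _)
  have hTb : PowerSeries.mk T = (1 - PowerSeries.mk b) * PowerSeries.mk 1 := by
    rw [sub_mul, mk_mul_mk_one]
    ext n
    simp [hT]
  have hTu (n : ℕ) : ∑ k ∈ Finset.range (n + 1), T k * u (n - k) = 1 := by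
    have h : PowerSeries.mk T * PowerSeries.mk u = PowerSeries.mk 1 := by
      rw [hTb]
      linear_combination (PowerSeries.mk 1 : PowerSeries ℝ) * hren
    rw [← coeff_mul_mk, h]
    simp
  have hT1 (N : ℕ) : c * ∑ k ∈ Finset.range N, T k ≤ 1 :=
    mul_sum_range_le_of_convolution_le hT0 hu hlim tendsto_const_nhds (fun n => (hTu n).le) N
  have hTs : Summable T := summable_of_sum_range_le hT0 (c := 1 / c) fun N => by
    rw [le_div_iff₀ hc, mul_comm]
    exact hT1 N
  set E : ℕ → ℝ := fun n => ∑ k ∈ Finset.range (n + 1), T k * (u (n - k) - c) with hE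
  have hEs : Summable E := by
    have := summable_norm_sum_mul_range_of_summable_norm (f := T) (g := fun n => u n - c)
      hTs.norm (by simpa using hsum)
    exact this.of_norm
  have hTE (n : ℕ) : c * ∑ k ∈ Finset.range (n + 1), T k + E n = 1 := by
    rw [← hTu n, hE, Finset.mul_sum, ← Finset.sum_add_distrib]
    exact Finset.sum_congr rfl fun k _ => by ring
  -- Since `c ∑ T ≤ 1` in total while the partial sum up to `n` falls short of `1` only by `E n`,
  -- the tails of `T` are summable. This gives `T` a first moment, and hence `b` a second one.
  have hTtail (n N : ℕ) (hn : n < N) : ∑ k ∈ Finset.Ico (n + 1) N, T k ≤ E n / c := by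
    rw [Finset.sum_Ico_eq_sub _ (Nat.succ_le_iff.2 hn), le_div_iff₀ hc]
    linarith [hTE n, hT1 N]
  have hTk : Summable fun k : ℕ => T k * (k : ℝ) := by
    have := summable_mul_sum_of_tail_le (g := fun _ => 1) hT0 (fun _ => zero_le_one) hTtail
      (by simpa using hEs.div_const c)
    simpa using this
  have hbtail (n N : ℕ) (hn : n < N) : ∑ k ∈ Finset.Ico (n + 1) N, b k ≤ T n := by
    rw [Finset.sum_Ico_eq_sub _ (Nat.succ_le_iff.2 hn), hT]
    linarith [hb1 N]
  -- Odd weights summed below `k` produce exactly `k ^ 2`.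
  have hodd (k : ℕ) : ∑ n ∈ Finset.range k, (2 * (n : ℝ) + 1) = (k : ℝ) ^ 2 := by
    induction k with
    | zero => simp
    | succ k ih => rw [Finset.sum_range_succ, ih]; push_cast; ring
  have := summable_mul_sum_of_tail_le (g := fun n => 2 * (n : ℝ) + 1) hb
    (fun n => by positivity) hbtail
    (((hTk.mul_left 2).add hTs).congr fun n => by ring)
  exact this.congr fun k => by rw [hodd, mul_comm]

/-! ### Perturbed renewal equations. -/

/-- The partial sums of a series with finite first moment converge summably fast. -/
theorem sum_norm_sub_tsum_le {d : ℕ → ℂ} {η : ℝ} (hd : Summable fun k : ℕ => (k : ℝ) * ‖d k‖)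
    (hds : Summable fun k => ‖d k‖) (hη : ∑' k : ℕ, (k : ℝ) * ‖d k‖ ≤ η) (N : ℕ) :
    ∑ n ∈ Finset.range N, ‖∑ k ∈ Finset.range (n + 1), d k - ∑' k, d k‖ ≤ η := by
  classical
  have hs (n : ℕ) : Summable fun k => if n < k then ‖d k‖ else 0 :=
    Summable.of_nonneg_of_le (fun k => by split_ifs <;> simp)
      (fun k => by split_ifs <;> simp) hds
  have hle (n : ℕ) : ‖∑ k ∈ Finset.range (n + 1), d k - ∑' k, d k‖ ≤
      ∑' k, if n < k then ‖d k‖ else 0 := by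
    have h1 : HasSum (fun k => if n < k then d k else 0)
        (∑' k, d k - ∑ k ∈ Finset.range (n + 1), d k) := by
      have h2 : HasSum (fun k => if k ∈ Finset.range (n + 1) then d k else 0)
          (∑ k ∈ Finset.range (n + 1), if k ∈ Finset.range (n + 1) then d k else 0) :=
        hasSum_sum_of_ne_finset_zero fun k hk => if_neg hk
      rw [Finset.sum_congr rfl fun k hk => if_pos hk] at h2
      have h3 : (fun k => if n < k then d k else 0) =
          fun k => d k - if k ∈ Finset.range (n + 1) then d k else 0 := by
        ext k
        simp only [Finset.mem_range]
        split_ifs <;> first | omega | simp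
      rw [h3]
      exact hds.of_norm.hasSum.sub h2
    rw [norm_sub_rev, ← h1.tsum_eq]
    have h3 : (fun k => if n < k then ‖d k‖ else 0) = fun k => ‖if n < k then d k else 0‖ := by
      ext k
      split_ifs <;> simp
    rw [h3]
    exact norm_tsum_le_tsum_norm (h3 ▸ hs n)
  refine (Finset.sum_le_sum fun n _ => hle n).trans ?_
  rw [← Summable.tsum_finsetSum fun n _ => hs n]
  -- After exchanging the sums, `d k` is counted once for each `n < k`, so at most `k` times.
  refine le_trans (Summable.tsum_le_tsum (fun k => ?_) (summable_sum fun n _ => hs n) hd) hη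
  rw [← Finset.sum_filter, Finset.sum_const, nsmul_eq_mul]
  refine mul_le_mul_of_nonneg_right ?_ (norm_nonneg _)
  exact_mod_cast (Finset.card_le_card (t := Finset.range k) fun n hn => by
    simp only [Finset.mem_filter] at hn
    exact Finset.mem_range.2 hn.2).trans (by simp)

/-- The solution of a perturbed renewal equation almost solves a first order recursion. -/
theorem norm_sub_sub_mul_sum_le {b u : ℕ → ℝ} {c : ℝ} (hc : 0 < c)
    (hren : PowerSeries.mk u * (1 - PowerSeries.mk b) = 1)
    (hsum : Summable fun n => |u n - c|) {γ G : ℕ → ℂ} {U η : ℝ}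
    (hG : PowerSeries.mk G * (1 - PowerSeries.mk γ) = 1) (hGU : ∀ m, ‖G m‖ ≤ U)
    (hγ0 : γ 0 = b 0) (hδ : Summable fun k : ℕ => (k : ℝ) * ‖γ k - b k‖)
    (hη : ∑' k : ℕ, (k : ℝ) * ‖γ k - b k‖ ≤ η) (m : ℕ) :
    ‖G m - c - c * (∑' k, (γ k - b k)) * ∑ j ∈ Finset.range m, G j‖ ≤
      |u m - c| + U * (2 * c + ∑' n, |u n - c|) * η := by
  have hU : 0 ≤ U := (norm_nonneg _).trans (hGU 0)
  set δ : ℕ → ℂ := fun k => γ k - b k with hδdef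
  set Δ : ℂ := ∑' k, δ k with hΔ
  set E : ℝ := ∑' n, |u n - c| with hE
  set e : ℕ → ℂ := fun n => ((u n - c : ℝ) : ℂ) with he
  have henorm (n : ℕ) : ‖e n‖ = |u n - c| := by simp only [he, Complex.norm_real, Real.norm_eq_abs]
  have hle (k : ℕ) : ‖δ k‖ ≤ k * ‖δ k‖ := by
    rcases Nat.eq_zero_or_pos k with rfl | hk
    · simp [hδdef, hγ0]
    · exact le_mul_of_one_le_left (norm_nonneg _) (by exact_mod_cast hk)
  have hδs : Summable fun k => ‖δ k‖ := Summable.of_nonneg_of_le (fun k => norm_nonneg _) hle hδ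
  have hD : ∑' k, ‖δ k‖ ≤ η := (Summable.tsum_le_tsum hle hδs hδ).trans hη
  have hη0 : 0 ≤ η := (tsum_nonneg fun _ => norm_nonneg _).trans hD
  have hΔη : ‖Δ‖ ≤ η := (norm_tsum_le_tsum_norm hδs).trans hD
  have hren' : PowerSeries.mk (fun n => (u n : ℂ)) * (1 - PowerSeries.mk (fun n => (b n : ℂ))) = 1 := by
    have h := congrArg (PowerSeries.map Complex.ofRealHom) hren
    simp only [map_mul, map_sub, map_one] at h
    exact h
  -- the perturbation kernel
  set v : ℕ → ℂ := fun n =>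
    c * ∑ k ∈ Finset.range (n + 1), δ k + ∑ k ∈ Finset.range (n + 1), e k * δ (n - k) with hv
  have hvmk : PowerSeries.mk (fun n => (u n : ℂ)) * PowerSeries.mk δ = PowerSeries.mk v := by
    ext n
    rw [coeff_mul_mk, PowerSeries.coeff_mk, hv]
    simp only
    rw [← Finset.sum_range_reflect δ, Finset.mul_sum, ← Finset.sum_add_distrib]
    refine Finset.sum_congr rfl fun k _ => ?_
    simp only [he, Nat.add_sub_cancel]
    push_cast
    ring
  have hδmk : PowerSeries.mk δ = PowerSeries.mk γ - PowerSeries.mk (fun n => (b n : ℂ)) := by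
    ext n
    simp [hδdef]
  -- Comparing the two renewal equations gives `G = u + (u * δ) * G`.
  have hGv : PowerSeries.mk G = PowerSeries.mk (fun n => (u n : ℂ)) +
      PowerSeries.mk v * PowerSeries.mk G := by
    rw [← hvmk, hδmk]
    linear_combination PowerSeries.mk (fun n => (u n : ℂ)) * hG - PowerSeries.mk G * hren'
  have hGm : G m = u m + ∑ k ∈ Finset.range (m + 1), v k * G (m - k) := by
    have h := congrArg (PowerSeries.coeff m) hGv
    rwa [map_add, coeff_mul_mk, PowerSeries.coeff_mk, PowerSeries.coeff_mk] at h
  -- `v n` differs from `c Δ` by `c` times a tail of `δ` and by `e * δ`; the first moment of `δ`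
  -- makes the former summable, with total `O(η)`.
  have hr : ∑ n ∈ Finset.range (m + 1), ‖v n - c * Δ‖ ≤ (c + E) * η := by
    have h1 := sum_norm_sub_tsum_le hδ hδs hη (m + 1)
    have h2 : ∑ n ∈ Finset.range (m + 1), ‖∑ k ∈ Finset.range (n + 1), e k * δ (n - k)‖ ≤
        E * η := by
      have hes : Summable fun k => ‖e k‖ := by simpa only [henorm] using hsum
      have h3 := tsum_mul_tsum_eq_tsum_sum_range_of_summable_norm (f := fun k => ‖e k‖)
        (g := fun k => ‖δ k‖) (by simpa using hes) (by simpa using hδs)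
      have h4 := summable_norm_sum_mul_range_of_summable_norm (f := fun k => ‖e k‖)
        (g := fun k => ‖δ k‖) (by simpa using hes) (by simpa using hδs)
      calc _ ≤ ∑ n ∈ Finset.range (m + 1), ∑ k ∈ Finset.range (n + 1), ‖e k‖ * ‖δ (n - k)‖ :=
            Finset.sum_le_sum fun n _ => (norm_sum_le _ _).trans (by simp only [norm_mul, le_refl])
        _ ≤ _ := h4.of_norm.sum_le_tsum _ fun n _ =>
            Finset.sum_nonneg fun k _ => by positivity
        _ = E * ∑' k, ‖δ k‖ := by rw [← h3, hE]; simp only [henorm]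
        _ ≤ E * η := mul_le_mul_of_nonneg_left hD (tsum_nonneg fun _ => abs_nonneg _)
    calc _ ≤ ∑ n ∈ Finset.range (m + 1), (c * ‖∑ k ∈ Finset.range (n + 1), δ k - Δ‖ +
          ‖∑ k ∈ Finset.range (n + 1), e k * δ (n - k)‖) := by
          refine Finset.sum_le_sum fun n _ => ?_
          have h5 : v n - c * Δ = c * (∑ k ∈ Finset.range (n + 1), δ k - Δ) +
              ∑ k ∈ Finset.range (n + 1), e k * δ (n - k) := by
            simp only [hv]
            ring
          rw [h5]
          refine (norm_add_le _ _).trans_eq ?_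
          rw [norm_mul, Complex.norm_real, Real.norm_of_nonneg hc.le]
      _ ≤ c * η + E * η := by
          rw [Finset.sum_add_distrib, ← Finset.mul_sum]
          exact add_le_add (mul_le_mul_of_nonneg_left h1 hc.le) h2
      _ = _ := by ring
  have hdecomp : G m - c - c * Δ * ∑ j ∈ Finset.range m, G j =
      e m + c * Δ * G m + ∑ k ∈ Finset.range (m + 1), (v k - c * Δ) * G (m - k) := by
    have h6 : ∑ k ∈ Finset.range (m + 1), G (m - k) = ∑ j ∈ Finset.range m, G j + G m := by
      rw [← Finset.sum_range_succ, ← Finset.sum_range_reflect G]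
      simp
    simp only [sub_mul, Finset.sum_sub_distrib]
    rw [← Finset.mul_sum, h6]
    simp only [he]
    push_cast
    linear_combination hGm
  rw [hdecomp]
  have h7 : ‖∑ k ∈ Finset.range (m + 1), (v k - c * Δ) * G (m - k)‖ ≤ (c + E) * η * U := by
    refine (norm_sum_le _ _).trans (le_trans ?_ (mul_le_mul_of_nonneg_right hr hU))
    rw [Finset.sum_mul]
    refine Finset.sum_le_sum fun k _ => ?_
    rw [norm_mul]
    exact mul_le_mul_of_nonneg_left (hGU _) (norm_nonneg _)
  have h8 : ‖c * Δ * G m‖ ≤ c * η * U := by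
    rw [norm_mul, norm_mul, Complex.norm_real, Real.norm_of_nonneg hc.le]
    exact mul_le_mul (mul_le_mul_of_nonneg_left hΔη hc.le) (hGU m) (norm_nonneg _)
      (mul_nonneg hc.le hη0)
  calc _ ≤ ‖e m‖ + ‖c * Δ * G m‖ + _ := norm_add₃_le
    _ ≤ |u m - c| + c * η * U + (c + E) * η * U :=
      add_le_add (add_le_add (henorm m).le h8) h7
    _ = _ := by ring

/-- A discrete Gronwall inequality. -/
theorem sum_range_le_of_le_add_mul_sum {D ε : ℕ → ℝ} {κ : ℝ} (hκ : 0 ≤ κ) (hε : ∀ n, 0 ≤ ε n)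
    (h : ∀ m, D m ≤ ε m + κ * ∑ j ∈ Finset.range m, D j) (m : ℕ) :
    ∑ j ∈ Finset.range m, D j ≤ (1 + κ) ^ m * ∑ j ∈ Finset.range m, ε j := by
  induction m with
  | zero => simp
  | succ m ih =>
    have h1 : 1 ≤ (1 + κ) ^ (m + 1) := one_le_pow₀ (by linarith)
    calc ∑ j ∈ Finset.range (m + 1), D j
        ≤ (1 + κ) * ∑ j ∈ Finset.range m, D j + ε m := by
          rw [Finset.sum_range_succ]
          linarith [h m]
      _ ≤ (1 + κ) * ((1 + κ) ^ m * ∑ j ∈ Finset.range m, ε j) + (1 + κ) ^ (m + 1) * ε m :=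
          add_le_add (mul_le_mul_of_nonneg_left ih (by linarith))
            (le_mul_of_one_le_left (hε m) h1)
      _ = _ := by rw [Finset.sum_range_succ]; ring

/-- A sequence that almost solves `G m = c + z * ∑ j < m, G j` is close to `c * (1 + z) ^ m`. -/
theorem norm_sub_mul_pow_le {G : ℕ → ℂ} {c z : ℂ} {ε : ℕ → ℝ}
    (h : ∀ m, ‖G m - c - z * ∑ j ∈ Finset.range m, G j‖ ≤ ε m) (m : ℕ) :
    ‖G m - c * (1 + z) ^ m‖ ≤
      ε m + ‖z‖ * ((1 + ‖z‖) ^ m * ∑ j ∈ Finset.range m, ε j) := by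
  have hε (n : ℕ) : 0 ≤ ε n := (norm_nonneg _).trans (h n)
  have hH (m : ℕ) : c * (1 + z) ^ m = c + z * ∑ j ∈ Finset.range m, c * (1 + z) ^ j := by
    induction m with
    | zero => simp
    | succ m ih => rw [Finset.sum_range_succ, mul_add, ← add_assoc, ← ih]; ring
  have hD (m : ℕ) : ‖G m - c * (1 + z) ^ m‖ ≤
      ε m + ‖z‖ * ∑ j ∈ Finset.range m, ‖G j - c * (1 + z) ^ j‖ := by
    have h1 : G m - c * (1 + z) ^ m = (G m - c - z * ∑ j ∈ Finset.range m, G j) +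
        z * ∑ j ∈ Finset.range m, (G j - c * (1 + z) ^ j) := by
      rw [Finset.sum_sub_distrib]
      linear_combination -hH m
    rw [h1]
    refine (norm_add_le _ _).trans (add_le_add (h m) ?_)
    rw [norm_mul]
    exact mul_le_mul_of_nonneg_left (norm_sum_le _ _) (norm_nonneg _)
  exact (hD m).trans (add_le_add le_rfl (mul_le_mul_of_nonneg_left
    (sum_range_le_of_le_add_mul_sum (norm_nonneg _) hε hD m) (norm_nonneg _)))

/-- The limit of the diagonal of a sequence of perturbed renewal equations. -/
theorem tendsto_diagonal_of_renewal {b u : ℕ → ℝ} {c : ℝ} (hc : 0 < c)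
    (hren : PowerSeries.mk u * (1 - PowerSeries.mk b) = 1)
    (hsum : Summable fun n => |u n - c|) {γ G : ℕ → ℕ → ℂ} {U : ℝ} {η : ℕ → ℝ} {L : ℂ}
    (hG : ∀ n, PowerSeries.mk (G n) * (1 - PowerSeries.mk (γ n)) = 1)
    (hGU : ∀ n m, ‖G n m‖ ≤ U) (hγ0 : ∀ n, γ n 0 = b 0)
    (hδ : ∀ n, Summable fun k : ℕ => (k : ℝ) * ‖γ n k - b k‖)
    (hη : ∀ n, ∑' k : ℕ, (k : ℝ) * ‖γ n k - b k‖ ≤ η n) (hη0 : Tendsto η atTop (𝓝 0))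
    (hL : Tendsto (fun n : ℕ => (n : ℂ) * ∑' k, (γ n k - b k)) atTop (𝓝 L)) :
    Tendsto (fun n => G n n) atTop (𝓝 (c * Complex.exp (c * L))) := by
  set E : ℝ := ∑' n, |u n - c| with hE
  set z : ℕ → ℂ := fun n => c * ∑' k, (γ n k - b k) with hz
  set K : ℝ := U * (2 * c + E) with hK
  have hnz : Tendsto (fun n : ℕ => (n : ℂ) * z n) atTop (𝓝 (c * L)) := by
    refine (hL.const_mul (c : ℂ)).congr fun n => ?_
    simp only [hz]
    ring
  have hnzn : Tendsto (fun n : ℕ => (n : ℝ) * ‖z n‖) atTop (𝓝 ‖c * L‖) := by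
    simpa using hnz.norm
  have hz0 : Tendsto (fun n => ‖z n‖) atTop (𝓝 0) := by
    have h1 := hnzn.mul tendsto_inv_atTop_nhds_zero_nat
    rw [mul_zero] at h1
    refine h1.congr' ?_
    filter_upwards [eventually_gt_atTop 0] with n hn
    have : (n : ℝ) ≠ 0 := by positivity
    field_simp
  have hpow := Real.tendsto_one_add_pow_exp_of_tendsto hnzn
  have he0 : Tendsto (fun n => |u n - c|) atTop (𝓝 0) := hsum.tendsto_atTop_zero
  have hKη : Tendsto (fun n => K * η n) atTop (𝓝 0) := by simpa using hη0.const_mul K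
  have hKη0 (n : ℕ) : 0 ≤ K * η n := by
    have hU : 0 ≤ U := (norm_nonneg _).trans (hGU 0 0)
    have hEn : 0 ≤ E := tsum_nonneg fun _ => abs_nonneg _
    exact mul_nonneg (by positivity) ((tsum_nonneg fun _ => by positivity).trans (hη n))
  -- The errors up to `n` add up to at most `E + n K η n`. The factor `‖z n‖ = O(1 / n)` makes both
  -- parts vanish, while `(1 + ‖z n‖) ^ n` stays bounded.
  have hbound (n : ℕ) : ‖G n n - c * (1 + z n) ^ n‖ ≤ (|u n - c| + K * η n) +
      (1 + ‖z n‖) ^ n * (‖z n‖ * E + n * ‖z n‖ * (K * η n)) := by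
    refine (norm_sub_mul_pow_le (norm_sub_sub_mul_sum_le hc hren hsum (hG n) (hGU n) (hγ0 n)
      (hδ n) (hη n)) n).trans (add_le_add le_rfl ?_)
    rw [Finset.sum_add_distrib, Finset.sum_const, Finset.card_range, nsmul_eq_mul, ← hE, ← hK]
    have h1 : ∑ j ∈ Finset.range n, |u j - c| ≤ E := hsum.sum_le_tsum _ fun _ _ => abs_nonneg _
    calc _ ≤ ‖z n‖ * ((1 + ‖z n‖) ^ n * (E + n * (K * η n))) := by gcongr
      _ = _ := by ring
  have hdiff : Tendsto (fun n => G n n - c * (1 + z n) ^ n) atTop (𝓝 0) := by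
    refine squeeze_zero_norm hbound ?_
    have h2 := (he0.add hKη).add (hpow.mul ((hz0.mul_const E).add (hnzn.mul hKη)))
    simpa using h2
  have hmain := (Complex.tendsto_one_add_pow_exp_of_tendsto hnz).const_mul (c : ℂ)
  simpa using hdiff.add hmain

/-! ### The central limit theorem for renewal reward sums. -/

/-- Valid for all real `y`, hence usable as a dominating bound: Taylor for `|y| ≤ 1`, the triangle
inequality otherwise. -/
theorem norm_exp_I_mul_sub_one_sub_le (y : ℝ) :
    ‖Complex.exp (Complex.I * y) - 1 - Complex.I * y‖ ≤ 2 * y ^ 2 := by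
  have hn : ‖Complex.I * (y : ℂ)‖ = |y| := by simp
  rcases le_total |y| 1 with h | h
  · refine (Complex.norm_exp_sub_one_sub_id_le (hn.trans_le h)).trans ?_
    rw [hn, sq_abs]
    nlinarith [sq_nonneg y]
  · refine (norm_sub_le _ _).trans ?_
    have h1 := Real.norm_exp_I_mul_ofReal_sub_one_le (x := y)
    rw [Real.norm_eq_abs] at h1
    rw [hn, ← sq_abs]
    nlinarith

theorem tendsto_mul_exp_sub_one_sub (s y : ℝ) :
    Tendsto (fun n : ℕ => (n : ℂ) * (Complex.exp (Complex.I * (s / √n * y : ℝ)) - 1 -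
      Complex.I * (s / √n * y : ℝ))) atTop (𝓝 (-((s * y) ^ 2 / 2 : ℝ))) := by
  have hy0 : Tendsto (fun n : ℕ => s / √n * y) atTop (𝓝 0) := by
    have h : Tendsto (fun n : ℕ => √(n : ℝ)) atTop atTop :=
      Real.tendsto_sqrt_atTop.comp tendsto_natCast_atTop_atTop
    simpa using (h.const_div_atTop s).mul_const y
  rw [tendsto_iff_norm_sub_tendsto_zero]
  have hb : Tendsto (fun n : ℕ => (s * y) ^ 2 * |s / √n * y|) atTop (𝓝 0) := by
    simpa using hy0.abs.const_mul ((s * y) ^ 2)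
  refine squeeze_zero' (Eventually.of_forall fun _ => norm_nonneg _) ?_ hb
  filter_upwards [eventually_gt_atTop 0,
    hy0.abs.eventually (Iio_mem_nhds (by simp : |(0 : ℝ)| < 1))] with n hn h1
  set y' : ℝ := s / √n * y with hy'
  have hny : (n : ℝ) * y' ^ 2 = (s * y) ^ 2 := by
    have h2 : √(n : ℝ) ^ 2 = n := Real.sq_sqrt (by positivity)
    have h3 : (n : ℝ) ≠ 0 := by positivity
    rw [hy', mul_pow, div_pow, h2]
    field_simp
  have hnorm : ‖Complex.I * (y' : ℂ)‖ = |y'| := by simp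
  have hexp := Complex.exp_bound (x := Complex.I * y') (hnorm.trans_le (le_of_lt h1))
    (n := 3) (by norm_num)
  rw [hnorm] at hexp
  have heq : (n : ℂ) * (Complex.exp (Complex.I * y') - 1 - Complex.I * y') -
      -(((s * y) ^ 2 / 2 : ℝ) : ℂ) = n * (Complex.exp (Complex.I * y') -
        ∑ m ∈ Finset.range 3, (Complex.I * y') ^ m / m.factorial) := by
    rw [← hny]
    simp only [Finset.sum_range_succ, Finset.sum_range_zero, mul_pow, Complex.I_sq]
    push_cast
    simp
    ring
  rw [heq, norm_mul, Complex.norm_natCast]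
  calc (n : ℝ) * _ ≤ n * (|y'| ^ 3 * 1) := by
        refine mul_le_mul_of_nonneg_left (hexp.trans ?_) (by positivity)
        refine mul_le_mul_of_nonneg_left ?_ (by positivity)
        norm_num [Nat.factorial]
    _ = _ := by
        rw [← hny, ← sq_abs y']
        ring

/-- The central limit theorem for renewal reward sums, in terms of the
renewal equation for the twisted partition functions. -/
theorem tendsto_renewal_reward {α : ℕ → Type*} {A : ∀ k, Finset (α k)} {w ξ : ∀ k, α k → ℝ}
    (hw : ∀ k a, 0 ≤ w k a) {M : ℝ} (hξ : ∀ k a, |ξ k a| ≤ M * k) {u : ℕ → ℝ} {c : ℝ}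
    (hc : 0 < c) (hren : PowerSeries.mk u * (1 - PowerSeries.mk fun k => ∑ a ∈ A k, w k a) = 1)
    (hsum : Summable fun n => |u n - c|)
    (hb2 : Summable fun k : ℕ => (k : ℝ) ^ 2 * ∑ a ∈ A k, w k a)
    (hmean : HasSum (fun k => ∑ a ∈ A k, w k a * ξ k a) 0)
    {s U : ℝ} {G : ℕ → ℕ → ℂ}
    (hG : ∀ n : ℕ, PowerSeries.mk (G n) * (1 - PowerSeries.mk fun k =>
      ∑ a ∈ A k, (w k a : ℂ) * Complex.exp (Complex.I * (s / √n * ξ k a : ℝ))) = 1)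
    (hGU : ∀ n m, ‖G n m‖ ≤ U) :
    Tendsto (fun n => G n n) atTop (𝓝 (c * Complex.exp
      (-(c * (∑' k, ∑ a ∈ A k, w k a * ξ k a ^ 2) * s ^ 2 / 2 : ℝ)))) := by
  set b : ℕ → ℝ := fun k => ∑ a ∈ A k, w k a with hb
  have hδ (n k : ℕ) : ∑ a ∈ A k, (w k a : ℂ) * Complex.exp (Complex.I * (s / √n * ξ k a : ℝ)) -
      b k = ∑ a ∈ A k, (w k a : ℂ) * (Complex.exp (Complex.I * (s / √n * ξ k a : ℝ)) - 1) := by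
    simp only [hb, Complex.ofReal_sum, mul_sub, mul_one, Finset.sum_sub_distrib]
  -- The reward is `O(k)`, so a first moment of the perturbation costs a second moment of the block
  -- size.
  have hδle (n k : ℕ) : (k : ℝ) * ‖∑ a ∈ A k, (w k a : ℂ) *
      Complex.exp (Complex.I * (s / √n * ξ k a : ℝ)) - b k‖ ≤
      |s / √n| * M * ((k : ℝ) ^ 2 * b k) := by
    rw [hδ]
    calc _ ≤ (k : ℝ) * ∑ a ∈ A k, w k a * (|s / √n| * (M * k)) := by
          refine mul_le_mul_of_nonneg_left (norm_sum_le_of_le _ fun a _ => ?_) (by positivity)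
          rw [norm_mul, Complex.norm_real, Real.norm_of_nonneg (hw k a)]
          refine mul_le_mul_of_nonneg_left ?_ (hw k a)
          refine Real.norm_exp_I_mul_ofReal_sub_one_le.trans ?_
          rw [Real.norm_eq_abs, abs_mul]
          exact mul_le_mul_of_nonneg_left (hξ k a) (abs_nonneg _)
      _ = _ := by rw [← Finset.sum_mul]; ring
  have hδs (n : ℕ) : Summable fun k : ℕ => (k : ℝ) * ‖∑ a ∈ A k, (w k a : ℂ) *
      Complex.exp (Complex.I * (s / √n * ξ k a : ℝ)) - b k‖ :=
    Summable.of_nonneg_of_le (fun k => by positivity) (hδle n) (hb2.mul_left _)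
  have hsn : Tendsto (fun n : ℕ => s / √(n : ℝ)) atTop (𝓝 0) :=
    (Real.tendsto_sqrt_atTop.comp tendsto_natCast_atTop_atTop).const_div_atTop s
  -- As the mean reward is zero, the linear Taylor term can be subtracted for free; only
  -- second-order terms, of size `1 / n`, remain.
  have hmeanC (n : ℕ) : HasSum (fun k => ∑ a ∈ A k,
      (w k a : ℂ) * (Complex.I * (s / √n * ξ k a : ℝ))) 0 := by
    have h := ((Complex.hasSum_ofReal.2 hmean).mul_left (Complex.I * ((s / √n : ℝ) : ℂ)))
    simp only [Complex.ofReal_zero, mul_zero] at h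
    refine Eq.mp (congrArg (fun f : ℕ → ℂ => HasSum f 0) (funext fun k => ?_)) h
    push_cast
    rw [Finset.mul_sum]
    exact Finset.sum_congr rfl fun a _ => by ring
  have hlimit : Tendsto (fun n : ℕ => (n : ℂ) * ∑' k, (∑ a ∈ A k, (w k a : ℂ) *
      Complex.exp (Complex.I * (s / √n * ξ k a : ℝ)) - b k)) atTop
      (𝓝 (∑' k, ∑ a ∈ A k, (w k a : ℂ) * (-((s * ξ k a) ^ 2 / 2 : ℝ)))) := by
    have hterm (n : ℕ) : (n : ℂ) * ∑' k, (∑ a ∈ A k, (w k a : ℂ) *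
        Complex.exp (Complex.I * (s / √n * ξ k a : ℝ)) - b k) =
        ∑' k, ∑ a ∈ A k, (w k a : ℂ) * (n * (Complex.exp (Complex.I * (s / √n * ξ k a : ℝ)) - 1 -
          Complex.I * (s / √n * ξ k a : ℝ))) := by
      have hs : Summable fun k => ∑ a ∈ A k, (w k a : ℂ) *
          Complex.exp (Complex.I * (s / √n * ξ k a : ℝ)) - b k := by
        refine Summable.of_norm_bounded_eventually_nat (hδs n) ?_
        filter_upwards [eventually_ge_atTop 1] with k hk
        exact le_mul_of_one_le_left (norm_nonneg _) (by exact_mod_cast hk)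
      have h := (hs.hasSum.sub (hmeanC n)).mul_left (n : ℂ)
      rw [sub_zero] at h
      rw [← h.tsum_eq]
      refine tsum_congr fun k => ?_
      rw [hδ, ← Finset.sum_sub_distrib, Finset.mul_sum]
      exact Finset.sum_congr rfl fun a _ => by ring
    simp only [hterm]
    refine tendsto_tsum_of_dominated_convergence (hb2.mul_left (2 * s ^ 2 * M ^ 2))
      (fun k => tendsto_finsetSum _ fun a _ => (tendsto_mul_exp_sub_one_sub s (ξ k a)).const_mul _)
      (Eventually.of_forall fun n k => ?_)
    calc _ ≤ ∑ a ∈ A k, w k a * (2 * s ^ 2 * (M * k) ^ 2) := by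
          refine norm_sum_le_of_le _ fun a _ => ?_
          rw [norm_mul, Complex.norm_real, Real.norm_of_nonneg (hw k a), norm_mul,
            Complex.norm_natCast]
          refine mul_le_mul_of_nonneg_left ?_ (hw k a)
          have hsq : ξ k a ^ 2 ≤ (M * k) ^ 2 := by
            rw [← sq_abs]
            exact pow_le_pow_left₀ (abs_nonneg _) (hξ k a) 2
          have hns : (n : ℝ) * (s / √n) ^ 2 ≤ s ^ 2 := by
            rw [div_pow, Real.sq_sqrt (by positivity)]
            rcases eq_or_ne (n : ℝ) 0 with h0 | h0
            · simp [h0, sq_nonneg]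
            · rw [mul_div_cancel₀ _ h0]
          calc _ ≤ (n : ℝ) * (2 * (s / √n * ξ k a) ^ 2) :=
                mul_le_mul_of_nonneg_left (norm_exp_I_mul_sub_one_sub_le _) (by positivity)
            _ = 2 * ((n : ℝ) * (s / √n) ^ 2) * ξ k a ^ 2 := by ring
            _ ≤ 2 * s ^ 2 * (M * k) ^ 2 := by gcongr
      _ = _ := by rw [← Finset.sum_mul]; ring
  have hmain := tendsto_diagonal_of_renewal hc hren hsum (γ := fun n k =>
      ∑ a ∈ A k, (w k a : ℂ) * Complex.exp (Complex.I * (s / √n * ξ k a : ℝ)))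
    (η := fun n : ℕ => |s / √n| * M * ∑' k : ℕ, (k : ℝ) ^ 2 * b k) hG hGU ?_ hδs ?_ ?_ hlimit
  · convert hmain using 4
    have h1 (k : ℕ) : ∑ a ∈ A k, (w k a : ℂ) * (-((s * ξ k a) ^ 2 / 2 : ℝ)) =
        ((-(s ^ 2 / 2) * ∑ a ∈ A k, w k a * ξ k a ^ 2 : ℝ) : ℂ) := by
      push_cast
      rw [Finset.mul_sum]
      exact Finset.sum_congr rfl fun a _ => by ring
    rw [tsum_congr h1, ← Complex.ofReal_tsum, tsum_mul_left]
    push_cast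
    ring
  · intro n
    simp only [hb, Complex.ofReal_sum]
    refine Finset.sum_congr rfl fun a _ => ?_
    have : ξ 0 a = 0 := by simpa using hξ 0 a
    simp [this]
  · intro n
    rw [← tsum_mul_left]
    exact Summable.tsum_le_tsum (hδle n) (hδs n) (hb2.mul_left _)
  · simpa using (hsn.abs.mul_const M).mul_const (∑' k : ℕ, (k : ℝ) ^ 2 * b k)

/-! ### Mallows weights and their twisted partition functions. -/

theorem mk_sum_mul_one_sub_mk_sum_blocks {R : Type*} [CommRing R]
    {f : ∀ n, Equiv.Perm (Fin n) × Equiv.Perm (Fin n) → R} (hf : IsMultiplicative f)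
    (h0 : ∑ p, f 0 p = 1) :
    PowerSeries.mk (fun n => ∑ p, f n p) *
      (1 - PowerSeries.mk fun k => ∑ p ∈ blocks k, f k p) = 1 := by
  have h : PowerSeries.mk (fun n => ∑ p, f n p) =
      1 + (PowerSeries.mk fun k => ∑ p ∈ blocks k, f k p) *
        PowerSeries.mk fun n => ∑ p, f n p := by
    ext n
    rw [map_add, PowerSeries.coeff_mul, PowerSeries.coeff_mk, PowerSeries.coeff_one]
    simp only [PowerSeries.coeff_mk]
    rcases Nat.eq_zero_or_pos n with rfl | hn
    · have hb : blocks 0 = ∅ := by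
        ext p
        simp [mem_blocks]
      simp [h0, hb]
    · rw [if_neg hn.ne', zero_add]
      exact sum_eq_sum_antidiagonal hf hn
  linear_combination h

/-- The mass of a pair of permutations under the product of two Mallows measures, normalized so that
the total mass converges as `n → ∞`. -/
noncomputable def weight (q q' : ℝ) (n : ℕ) (p : Equiv.Perm (Fin n) × Equiv.Perm (Fin n)) : ℝ :=
  q ^ inversionNumber p.1 * q' ^ inversionNumber p.2 * ((1 - q) * (1 - q')) ^ n

theorem weight_pos {q q' : ℝ} (hq : 0 < q) (hq1 : q < 1) (hq' : 0 < q') (hq1' : q' < 1) (n : ℕ)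
    (p : Equiv.Perm (Fin n) × Equiv.Perm (Fin n)) : 0 < weight q q' n p := by
  have := sub_pos.2 hq1
  have := sub_pos.2 hq1'
  unfold weight
  positivity

theorem isMultiplicative_weight (q q' : ℝ) : IsMultiplicative (weight q q') := by
  intro k m p r
  simp only [weight, inversionNumber_directSum]
  ring

theorem sum_weight (q q' : ℝ) (n : ℕ) :
    ∑ p, weight q q' n p = normalizer n q * (1 - q) ^ n * (normalizer n q' * (1 - q') ^ n) := by
  have h : normalizer n q * normalizer n q' =
      ∑ p : Equiv.Perm (Fin n) × Equiv.Perm (Fin n),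
        q ^ inversionNumber p.1 * q' ^ inversionNumber p.2 := by
    rw [normalizer, normalizer, Finset.sum_mul_sum, Fintype.sum_prod_type]
  simp only [weight]
  rw [← Finset.sum_mul, ← h, mul_pow]
  ring

/-- The weight of a pair of permutations twisted by the character with frequency `θ` of the
centered length of the longest common subsequence. -/
noncomputable def twistedWeight (q q' a θ : ℝ) (n : ℕ)
    (p : Equiv.Perm (Fin n) × Equiv.Perm (Fin n)) : ℂ :=
  weight q q' n p * Complex.exp (Complex.I * (θ * (lcs p.1 p.2 - a * n) : ℝ))

theorem isMultiplicative_twistedWeight (q q' a θ : ℝ) :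
    IsMultiplicative (twistedWeight q q' a θ) := by
  intro k m p r
  simp only [twistedWeight, isMultiplicative_weight q q' k m p r, lcs_directSum]
  have h : Complex.I * ((θ * (((lcs p.1 p.2 + lcs r.1 r.2 : ℕ) : ℝ) - a * ((k + m : ℕ) : ℝ)) : ℝ) : ℂ)
      = Complex.I * ((θ * (lcs p.1 p.2 - a * k) : ℝ) : ℂ) +
        Complex.I * ((θ * (lcs r.1 r.2 - a * m) : ℝ) : ℂ) := by
    push_cast
    ring
  rw [h, Complex.exp_add]
  push_cast
  ring

theorem norm_sum_twistedWeight_le {q q' : ℝ} (hq : 0 < q) (hq1 : q < 1) (hq' : 0 < q')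
    (hq1' : q' < 1) (a θ : ℝ) (n : ℕ) :
    ‖∑ p, twistedWeight q q' a θ n p‖ ≤ ∑ p, weight q q' n p := by
  refine norm_sum_le_of_le _ fun p _ => ?_
  rw [twistedWeight, norm_mul, mul_comm Complex.I, Complex.norm_exp_ofReal_mul_I, mul_one,
    Complex.norm_real, Real.norm_of_nonneg (weight_pos hq hq1 hq' hq1' n p).le]

theorem inversionNumber_zero (π : Equiv.Perm (Fin 0)) : inversionNumber π = 0 := by
  simp [inversionNumber, inversionSet]

theorem lcs_zero (π τ : Equiv.Perm (Fin 0)) : lcs π τ = 0 :=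
  Nat.le_zero.1 (lcs_le π τ)

theorem mem_blocks_one (p : Equiv.Perm (Fin 1) × Equiv.Perm (Fin 1)) : p ∈ blocks 1 := by
  rw [mem_blocks]
  exact ⟨one_pos, fun k h0 h1 => absurd h1 (by omega)⟩

theorem lcs_one (π τ : Equiv.Perm (Fin 1)) : lcs π τ = 1 := by
  refine le_antisymm (lcs_le π τ) ?_
  have h := card_le_lcs (π := π) (τ := τ) (S := {0}) (by simp)
  simpa using h

/-- Together with `lcs_one_swap`, this block rules out a degenerate variance when `a = 1`. -/
theorem one_swap_mem_blocks : (1, Equiv.swap 0 1) ∈ blocks 2 := by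
  rw [mem_blocks]
  refine ⟨two_pos, fun k h0 h1 h => ?_⟩
  obtain rfl : k = 1 := by omega
  have := (h 0 (by simp)).2
  simp at this

theorem lcs_one_swap : lcs (1 : Equiv.Perm (Fin 2)) (Equiv.swap 0 1) < 2 := by
  by_contra! h
  obtain ⟨S, hS, hmono⟩ := exists_card_eq_lcs (1 : Equiv.Perm (Fin 2)) (Equiv.swap 0 1)
  have hu : S = Finset.univ := by
    rw [← Finset.card_eq_iff_eq_univ, hS]
    exact le_antisymm (lcs_le _ _) (by simpa using h)
  have := hmono (a := 0) (b := 1) (by simp [hu]) (by simp [hu]) (by simp)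
  simp at this

/-- The twisted partition functions converge to those of a Gaussian, after centering and
scaling. -/
theorem exists_tendsto_sum_twistedWeight {q q' : ℝ} (hq : 0 < q) (hq1 : q < 1) (hq' : 0 < q')
    (hq1' : q' < 1) :
    ∃ a σ c : ℝ, 0 < a ∧ 0 < σ ∧ 0 < c ∧
      Tendsto (fun n => ∑ p, weight q q' n p) atTop (𝓝 c) ∧
      ∀ t : ℝ, Tendsto (fun n : ℕ => ∑ p, twistedWeight q q' a (t / (σ * √n)) n p) atTop
        (𝓝 (c * Complex.exp (-t ^ 2 / 2))) := by
  have hw := weight_pos hq hq1 hq' hq1'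
  obtain ⟨c, hc, hlim, hsum⟩ := exists_tendsto_normalizer_mul_pow hq hq1 hq' hq1'
    (u := fun n => ∑ p, weight q q' n p) (sum_weight q q')
  have h0 : ∑ p, weight q q' 0 p = 1 := by simp [weight, inversionNumber_zero]
  have hren := mk_sum_mul_one_sub_mk_sum_blocks (isMultiplicative_weight q q') h0
  have hb (k : ℕ) : 0 ≤ ∑ p ∈ blocks k, weight q q' k p :=
    Finset.sum_nonneg fun p _ => (hw k p).le
  have hb2 := summable_sq_mul_of_renewal hb
    (fun n => Finset.sum_nonneg fun p _ => (hw n p).le) hren hc hlim hsum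
  have hb1 : Summable fun k : ℕ => (k : ℝ) * ∑ p ∈ blocks k, weight q q' k p := by
    refine Summable.of_nonneg_of_le (fun k => mul_nonneg (by positivity) (hb k)) (fun k => ?_) hb2
    refine mul_le_mul_of_nonneg_right ?_ (hb k)
    exact_mod_cast Nat.le_self_pow two_ne_zero k
  have hlk {k : ℕ} (p : Equiv.Perm (Fin k) × Equiv.Perm (Fin k)) : (lcs p.1 p.2 : ℝ) ≤ k := by
    exact_mod_cast lcs_le p.1 p.2
  have hY : Summable fun k : ℕ => ∑ p ∈ blocks k, weight q q' k p * lcs p.1 p.2 := by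
    refine Summable.of_nonneg_of_le
      (fun k => Finset.sum_nonneg fun p _ => mul_nonneg (hw k p).le (by positivity)) (fun k => ?_) hb1
    rw [Finset.mul_sum]
    refine Finset.sum_le_sum fun p _ => ?_
    rw [mul_comm]
    exact mul_le_mul_of_nonneg_right (hlk p) (hw k p).le
  have hb1pos : 0 < ∑' k : ℕ, (k : ℝ) * ∑ p ∈ blocks k, weight q q' k p := by
    refine hb1.tsum_pos (fun k => mul_nonneg (by positivity) (hb k)) 1 ?_
    simp only [Nat.cast_one, one_mul]
    exact Finset.sum_pos (fun p _ => hw 1 p) ⟨1, mem_blocks_one 1⟩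
  have hYpos : 0 < ∑' k : ℕ, ∑ p ∈ blocks k, weight q q' k p * lcs p.1 p.2 := by
    refine hY.tsum_pos
      (fun k => Finset.sum_nonneg fun p _ => mul_nonneg (hw k p).le (by positivity)) 1 ?_
    simp only [lcs_one, Nat.cast_one, mul_one]
    exact Finset.sum_pos (fun p _ => hw 1 p) ⟨1, mem_blocks_one 1⟩
  -- The ratio of mean block LCS to mean block size is the centering that makes the mean reward
  -- vanish.
  set a : ℝ := (∑' k : ℕ, ∑ p ∈ blocks k, weight q q' k p * lcs p.1 p.2) /
    ∑' k : ℕ, (k : ℝ) * ∑ p ∈ blocks k, weight q q' k p with ha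
  have ha0 : 0 < a := div_pos hYpos hb1pos
  set ξ : ∀ k, Equiv.Perm (Fin k) × Equiv.Perm (Fin k) → ℝ :=
    fun k p => lcs p.1 p.2 - a * k with hξdef
  have hξ (k : ℕ) (p) : |ξ k p| ≤ (1 + a) * k := by
    have h1 := hlk p
    have h2 : (0 : ℝ) ≤ lcs p.1 p.2 := by positivity
    have h3 : 0 ≤ a * k := by positivity
    have h4 : (0 : ℝ) ≤ k := by positivity
    rw [abs_le]
    constructor <;> simp only [hξdef] <;> linarith
  have hmean : HasSum (fun k => ∑ p ∈ blocks k, weight q q' k p * ξ k p) 0 := by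
    have h := hY.hasSum.sub (hb1.hasSum.mul_left a)
    rw [ha, div_mul_cancel₀ _ hb1pos.ne', sub_self, ← ha] at h
    refine Eq.mp (congrArg (fun f : ℕ → ℝ => HasSum f 0) (funext fun k => ?_)) h
    rw [Finset.mul_sum, Finset.mul_sum, ← Finset.sum_sub_distrib]
    exact Finset.sum_congr rfl fun p _ => by simp only [hξdef]; ring
  set V : ℝ := ∑' k, ∑ p ∈ blocks k, weight q q' k p * ξ k p ^ 2 with hV
  have hVterm (k : ℕ) : 0 ≤ ∑ p ∈ blocks k, weight q q' k p * ξ k p ^ 2 :=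
    Finset.sum_nonneg fun p _ => mul_nonneg (hw k p).le (sq_nonneg _)
  have hVs : Summable fun k => ∑ p ∈ blocks k, weight q q' k p * ξ k p ^ 2 := by
    refine Summable.of_nonneg_of_le hVterm (fun k => ?_) (hb2.mul_left ((1 + a) ^ 2))
    rw [Finset.mul_sum, Finset.mul_sum]
    refine Finset.sum_le_sum fun p _ => ?_
    have : ξ k p ^ 2 ≤ ((1 + a) * k) ^ 2 := by
      rw [← sq_abs]
      exact pow_le_pow_left₀ (abs_nonneg _) (hξ k p) 2
    calc _ ≤ weight q q' k p * ((1 + a) * k) ^ 2 :=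
          mul_le_mul_of_nonneg_left this (hw k p).le
      _ = _ := by ring
  have hVpos : 0 < V := by
    have hpos {k : ℕ} {p} (hp : p ∈ blocks k) (h : ξ k p ≠ 0) : 0 < V := by
      refine hVs.tsum_pos hVterm k ?_
      exact Finset.sum_pos' (fun p _ => mul_nonneg (hw k p).le (sq_nonneg _))
        ⟨p, hp, mul_pos (hw k p) (by positivity)⟩
    -- The block of size `1` has reward `1 - a`; if this is zero, the block `(1, swap 0 1)` has
    -- negative reward.
    by_cases h1 : a = 1
    · refine hpos one_swap_mem_blocks (ne_of_lt ?_)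
      have h2 : (lcs (1 : Equiv.Perm (Fin 2)) (Equiv.swap 0 1) : ℝ) < 2 := by
        exact_mod_cast lcs_one_swap
      simp only [hξdef, h1]
      push_cast
      linarith
    · refine hpos (mem_blocks_one 1) ?_
      simp only [hξdef, lcs_one, Nat.cast_one, mul_one]
      exact sub_ne_zero.2 (Ne.symm h1)
  have hσ : 0 < √(c * V) := Real.sqrt_pos.2 (mul_pos hc hVpos)
  refine ⟨a, √(c * V), c, ha0, hσ, hc, hlim, fun t => ?_⟩
  have hU (n : ℕ) : ∑ p, weight q q' n p ≤ c + ∑' n, |∑ p, weight q q' n p - c| := by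
    have h1 := hsum.le_tsum n fun _ _ => abs_nonneg _
    have h2 := le_abs_self (∑ p, weight q q' n p - c)
    linarith
  have hmain := tendsto_renewal_reward (fun k p => (hw k p).le) hξ hc hren hsum hb2 hmean
    (s := t / √(c * V))
    -- The frequency depends on `n` and the size on `m`: for fixed `n` this is a renewal sequence in
    -- `m`, evaluated in the end at `m = n`.
    (G := fun n m => ∑ p, twistedWeight q q' a (t / √(c * V) / √n) m p)
    (fun n => mk_sum_mul_one_sub_mk_sum_blocks (isMultiplicative_twistedWeight q q' a _)
      (by simp [twistedWeight, weight, inversionNumber_zero, lcs_zero]))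
    (fun n m => (norm_sum_twistedWeight_le hq hq1 hq' hq1' a _ m).trans (hU m))
  simp only [div_div] at hmain
  convert hmain using 4
  rw [← hV, div_pow, Real.sq_sqrt (mul_pos hc hVpos).le, mul_div_cancel₀ _ (mul_pos hc hVpos).ne']
  push_cast
  ring

/-! ### Characteristic functions and the conclusion. -/

theorem aemeasurable_lcs {n : ℕ} {Ω : Type*} [MeasurableSpace Ω] {P : Measure Ω}
    {π τ : Ω → Equiv.Perm (Fin n)} (hπ : AEMeasurable π P) (hτ : AEMeasurable τ P) :
    AEMeasurable (fun ω => (lcs (π ω) (τ ω) : ℝ)) P := by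
  have h : Measurable fun p : Equiv.Perm (Fin n) × Equiv.Perm (Fin n) => (lcs p.1 p.2 : ℝ) :=
    .of_discrete
  have hcomp := h.comp_aemeasurable (hπ.prodMk hτ)
  exact hcomp

/-- The characteristic function of a function of two independent Mallows permutations. -/
theorem charFun_map_eq_sum {q q' : ℝ} (hq : 0 < q) (hq1 : q < 1) (hq' : 0 < q') (hq1' : q' < 1)
    {n : ℕ} {Ω : Type*} [MeasurableSpace Ω] {P : Measure Ω} [IsProbabilityMeasure P]
    {π τ : Ω → Equiv.Perm (Fin n)} (hπ : HasLaw π (mallowsMeasure n q) P)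
    (hτ : HasLaw τ (mallowsMeasure n q') P) (hind : IndepFun π τ P) (a s t : ℝ) :
    charFun (P.map fun ω => ((lcs (π ω) (τ ω) : ℝ) - a * n) / s) t =
      (∑ p, twistedWeight q q' a (t / s) n p) / (∑ p, weight q q' n p : ℝ) := by
  have := isProbabilityMeasure_mallowsMeasure n hq
  have := isProbabilityMeasure_mallowsMeasure n hq'
  have hZ {y : ℝ} (hy : 0 < y) : 0 < normalizer n y :=
    Finset.sum_pos (fun π _ => pow_pos hy _) Finset.univ_nonempty
  have hlaw : P.map (fun ω => (π ω, τ ω)) = (mallowsMeasure n q).prod (mallowsMeasure n q') := by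
    rw [(indepFun_iff_map_prod_eq_prod_map_map hπ.aemeasurable hτ.aemeasurable).1 hind, hπ.map_eq,
      hτ.map_eq]
  have hmap : P.map (fun ω => ((lcs (π ω) (τ ω) : ℝ) - a * n) / s) =
      ((mallowsMeasure n q).prod (mallowsMeasure n q')).map
        fun p => ((lcs p.1 p.2 : ℝ) - a * n) / s := by
    rw [← hlaw, AEMeasurable.map_map_of_aemeasurable (measurable_of_finite _).aemeasurable
      (hπ.aemeasurable.prodMk hτ.aemeasurable)]
    rfl
  rw [hmap, charFun_apply_real, integral_map (measurable_of_finite _).aemeasurable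
    (by fun_prop), integral_fintype (Integrable.of_finite), Finset.sum_div]
  refine Finset.sum_congr rfl fun p _ => ?_
  have hreal {y : ℝ} (hy : 0 < y) (σ : Equiv.Perm (Fin n)) :
      (mallowsMeasure n y).real {σ} = y ^ inversionNumber σ / normalizer n y := by
    rw [measureReal_def, mallowsMeasure_singleton, ENNReal.toReal_ofReal]
    have := hZ hy
    positivity
  have hp : ((mallowsMeasure n q).prod (mallowsMeasure n q')).real {p} =
      weight q q' n p / ∑ p, weight q q' n p := by
    rw [← Prod.mk.eta (p := p), ← Set.singleton_prod_singleton, measureReal_prod_prod, hreal hq,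
      hreal hq', sum_weight, weight, mul_pow]
    have := sub_pos.2 hq1
    have := sub_pos.2 hq1'
    have := hZ hq
    have := hZ hq'
    field_simp
  rw [hp, twistedWeight, Complex.real_smul]
  have he : (t : ℂ) * ((((lcs p.1 p.2 : ℝ) - a * n) / s : ℝ) : ℂ) * Complex.I =
      Complex.I * ((t / s * (lcs p.1 p.2 - a * n) : ℝ) : ℂ) := by
    push_cast
    ring
  rw [he]
  push_cast
  ring

end Mallows

theorem theorem1p2 (q q' : ℝ) (hq : 0 < q) (hq1 : q < 1) (hq' : 0 < q') (hq1' : q' < 1) :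
    ∃ a σ : ℝ, 0 < a ∧ 0 < σ ∧
      ∀ (Ω : ℕ → Type*) [∀ n, MeasurableSpace (Ω n)] (P : ∀ n, Measure (Ω n))
        [∀ n, IsProbabilityMeasure (P n)] (π τ : ∀ n, Ω n → Equiv.Perm (Fin n)),
        (∀ n, 0 < n → HasLaw (π n) (Mallows.mallowsMeasure n q) (P n)) →
        (∀ n, 0 < n → HasLaw (τ n) (Mallows.mallowsMeasure n q') (P n)) →
        (∀ n, 0 < n → IndepFun (π n) (τ n) (P n)) →
        TendstoInDistribution
          (fun (n : ℕ) (ω : Ω n) =>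
            ((Mallows.lcs (π n ω) (τ n ω) : ℝ) - a * n) / (σ * Real.sqrt n))
          atTop (fun x : ℝ => x) P (gaussianReal 0 1) := by
  obtain ⟨a, σ, c, ha, hσ, hc, hlim, htwist⟩ :=
    Mallows.exists_tendsto_sum_twistedWeight hq hq1 hq' hq1'
  refine ⟨a, σ, ha, hσ, fun Ω _ P _ π τ hπ hτ hind => ?_⟩
  refine ⟨fun n => ?_, by fun_prop, ?_⟩
  -- Nothing is assumed at `n = 0`, but there the LCS is constantly `0`.
  · rcases Nat.eq_zero_or_pos n with rfl | hn
    · simp only [Mallows.lcs_zero]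
      fun_prop
    · have hlcs := Mallows.aemeasurable_lcs (hπ n hn).aemeasurable (hτ n hn).aemeasurable
      exact (hlcs.sub_const _).div_const _
  · refine ProbabilityMeasure.tendsto_iff_tendsto_charFun.2 fun t => ?_
    -- The characteristic function is the twisted mass over the plain mass, so the constant `c`
    -- cancels in the limit.
    have h := (htwist t).div (Complex.continuous_ofReal.continuousAt.tendsto.comp hlim)
      (by exact_mod_cast hc.ne')
    rw [mul_div_cancel_left₀ _ (by exact_mod_cast hc.ne')] at h
    have hid : (gaussianReal 0 1).map (fun x : ℝ => x) = gaussianReal 0 1 := Measure.map_id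
    simp only [ProbabilityMeasure.coe_mk, hid, charFun_gaussianReal]
    have he : Complex.exp (t * (0 : ℝ) * Complex.I - ((1 : NNReal) : ℝ) * t ^ 2 / 2) =
        Complex.exp (-t ^ 2 / 2) := by
      congr 1
      simp
      ring
    simp only [he]
    refine h.congr' ?_
    filter_upwards [eventually_gt_atTop 0] with n hn
    exact (Mallows.charFun_map_eq_sum hq hq1 hq' hq1' (hπ n hn) (hτ n hn) (hind n hn) a _ t).symm
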